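/- Let $M$ be a smooth manifold (without boundary, not necessarily compact or connected) of dimension $2n$ with $n>2$, let $\omega$ be a symplectic form on $M$, that is, a smooth closed non-degenerate $2$-form, and let $0<k<n$. Write $\omega^k=\omega\wedge\dots\wedge\omega$ ($k$ factors). For a differential form $\eta$ on $M$ let $\mathrm{Diff}(M,\eta)$ be the group of diffeomorphisms $\varphi$ of $M$ with $\varphi^*\eta=\eta$, and let its identity component $\mathrm{Diff}_0(M,\eta)$ consist of those $\varphi$ for which there are diffeomorphisms $f_t\in \mathrm{Diff}(M,\eta)$, $t\in[0,1]$, such that $(x,t)\mapsto f_t(x)$ is a smooth map $M\times[0,1]\to M$, $f_0=\mathrm{id}$ and $f_1=\varphi$. Put $\mathrm{Symp}(M,\omega)=\mathrm{Diff}(M,\omega)$ and $\mathrm{Symp}_0(M,\omega)=\mathrm{Diff}_0(M,\omega)$. Then every element of $\mathrm{Diff}_0(M,\omega^k)$ is a symplectomorphism, i.e. $\mathrm{Diff}_0(M,\omega^k)\subseteq\mathrm{Symp}(M,\omega)$, and $$\mathrm{Diff}_0(M,\omega^k)=\mathrm{Symp}_0(M,\omega).$$ -/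

import Mathlib

open scoped Manifold ContDiff

noncomputable section

namespace SymplecticPowers

/-! ### Exterior algebra of a real vector space -/

section Linear

variable {V : Type*} [AddCommGroup V] [Module ℝ V]

/-- The wedge product of a `p`-form and a `q`-form on a real vector space:
the signed sum over `(p, q)`-shuffles of the products of values. -/
def wedge {p q : ℕ} (a : V [⋀^Fin p]→ₗ[ℝ] ℝ) (b : V [⋀^Fin q]→ₗ[ℝ] ℝ) :
    V [⋀^Fin (p + q)]→ₗ[ℝ] ℝ :=
  ((LinearMap.mul' ℝ ℝ).compAlternatingMap (a.domCoprod b)).domDomCongr finSumFinEquiv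

/-- The exterior power `a ∧ ⋯ ∧ a` (`k` factors) of a 2-form `a`; for `k = 0` it is the
constant `1`. -/
def wedgePow (a : V [⋀^Fin 2]→ₗ[ℝ] ℝ) : (k : ℕ) → V [⋀^Fin (2 * k)]→ₗ[ℝ] ℝ
  | 0 => AlternatingMap.constOfIsEmpty ℝ V (Fin 0) 1
  | k + 1 => wedge (wedgePow a k) a

end Linear

/-! ### Forms on a manifold without boundary of dimension `m` -/

section Manifold

variable {m : ℕ} {M : Type*} [TopologicalSpace M] [ChartedSpace (EuclideanSpace ℝ (Fin m)) M]

/-- The coordinate expression of a 2-form `Ω` in the chart around `x₀`: the pullback of `Ω` under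
the inverse of the chart. It is meaningful on the (open) target of the chart. -/
def chartForm (Ω : ∀ x : M, TangentSpace (𝓡 m) x [⋀^Fin 2]→L[ℝ] ℝ) (x₀ : M)
    (y : EuclideanSpace ℝ (Fin m)) : EuclideanSpace ℝ (Fin m) [⋀^Fin 2]→L[ℝ] ℝ :=
  (Ω ((extChartAt (𝓡 m) x₀).symm y)).compContinuousLinearMap
    (mfderiv 𝓘(ℝ, EuclideanSpace ℝ (Fin m)) (𝓡 m) (extChartAt (𝓡 m) x₀).symm y)

/-- A symplectic form: a smooth, closed, nondegenerate 2-form. -/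
structure IsSymplecticForm (Ω : ∀ x : M, TangentSpace (𝓡 m) x [⋀^Fin 2]→L[ℝ] ℝ) : Prop where
  smooth : ∀ x₀ : M, ContDiffOn ℝ ∞ (chartForm Ω x₀) (extChartAt (𝓡 m) x₀).target
  closed : ∀ x₀ : M, ∀ y ∈ (extChartAt (𝓡 m) x₀).target, extDeriv (chartForm Ω x₀) y = 0
  nondegenerate : ∀ (x : M) (v : TangentSpace (𝓡 m) x), (∀ w, Ω x ![v, w] = 0) → v = 0

/-- The 2-form `Ω`, as a field of alternating forms. -/
def toForm (Ω : ∀ x : M, TangentSpace (𝓡 m) x [⋀^Fin 2]→L[ℝ] ℝ) (x : M) :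
    TangentSpace (𝓡 m) x [⋀^Fin 2]→ₗ[ℝ] ℝ :=
  (Ω x).toAlternatingMap

/-- The `2k`-form `Ω ^ k`. -/
def formPow (Ω : ∀ x : M, TangentSpace (𝓡 m) x [⋀^Fin 2]→L[ℝ] ℝ) (k : ℕ) (x : M) :
    TangentSpace (𝓡 m) x [⋀^Fin (2 * k)]→ₗ[ℝ] ℝ :=
  wedgePow (toForm Ω x) k

/-- The pullback of a `p`-form `η` under a map `φ : M → M`. -/
def pullback {p : ℕ} (φ : M → M) (η : ∀ x : M, TangentSpace (𝓡 m) x [⋀^Fin p]→ₗ[ℝ] ℝ) (x : M) :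
    TangentSpace (𝓡 m) x [⋀^Fin p]→ₗ[ℝ] ℝ :=
  (η (φ x)).compLinearMap (mfderiv (𝓡 m) (𝓡 m) φ x).toLinearMap

/-- The diffeomorphisms of `M` that preserve the form `η`. -/
def DiffPreserving {p : ℕ} (η : ∀ x : M, TangentSpace (𝓡 m) x [⋀^Fin p]→ₗ[ℝ] ℝ) :
    Set (M ≃ₘ⟮𝓡 m, 𝓡 m⟯ M) :=
  {φ | pullback φ η = η}

/-- The identity component of the diffeomorphisms preserving `η`: those `φ` that are joined to the
identity by a path `f t`, `0 ≤ t ≤ 1`, of `η`-preserving diffeomorphisms such that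
`(x, t) ↦ f t x` is smooth on `M × [0, 1]`. The values of `f` outside `[0, 1]` are irrelevant. -/
def DiffPreserving₀ {p : ℕ} (η : ∀ x : M, TangentSpace (𝓡 m) x [⋀^Fin p]→ₗ[ℝ] ℝ) :
    Set (M ≃ₘ⟮𝓡 m, 𝓡 m⟯ M) :=
  {φ | ∃ f : ℝ → (M ≃ₘ⟮𝓡 m, 𝓡 m⟯ M),
    ContMDiffOn ((𝓡 m).prod 𝓘(ℝ, ℝ)) (𝓡 m) ∞ (fun q : M × ℝ => f q.2 q.1)
      (Set.univ ×ˢ Set.Icc (0 : ℝ) 1) ∧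
    (∀ t ∈ Set.Icc (0 : ℝ) 1, f t ∈ DiffPreserving η) ∧
    f 0 = Diffeomorph.refl (𝓡 m) M ∞ ∧ f 1 = φ}

/-- `Symp(M, Ω)`, the symplectomorphisms. -/
def Symp (Ω : ∀ x : M, TangentSpace (𝓡 m) x [⋀^Fin 2]→L[ℝ] ℝ) : Set (M ≃ₘ⟮𝓡 m, 𝓡 m⟯ M) :=
  DiffPreserving (toForm Ω)

/-- `Symp₀(M, Ω)`, the identity component of the group of symplectomorphisms. -/
def Symp₀ (Ω : ∀ x : M, TangentSpace (𝓡 m) x [⋀^Fin 2]→L[ℝ] ℝ) : Set (M ≃ₘ⟮𝓡 m, 𝓡 m⟯ M) :=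
  DiffPreserving₀ (toForm Ω)

/-- `Diff₀(M, Ω ^ k)`, the identity component of the group of `Ω ^ k`-preserving
diffeomorphisms. -/
def DiffPow₀ (Ω : ∀ x : M, TangentSpace (𝓡 m) x [⋀^Fin 2]→L[ℝ] ℝ) (k : ℕ) :
    Set (M ≃ₘ⟮𝓡 m, 𝓡 m⟯ M) :=
  DiffPreserving₀ (formPow Ω k)

end Manifold

end SymplecticPowers

end

/-!
The heart of the matter is linear algebra: if `a ^ k = o ^ k` for 2-forms `a` and `o` with
`0 < 2 * k < rank o`, then `a = ±o`. Let `v` be a vector and `w` a family of `2 * k` vectors that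
are `o`-orthogonal to `v` and satisfy `o ^ k (w) ≠ 0`. Since an alternating form on an odd number of
vectors is degenerate, some nontrivial combination `x` of `v` and the `w i` is `a`-orthogonal to all
of them. Substituting `x` for `w i` makes `a ^ k` vanish, but multiplies `o ^ k (w)` by the
coefficient of `w i` in `x`. So `x` is a nonzero multiple of `v`, and `v` is `a`-orthogonal to
every `w i`. Most vectors of the `o`-orthogonal complement of `v` extend to such a family `w` made
of `k` hyperbolic pairs, hence `o`-orthogonality implies `a`-orthogonality. It follows that
`a = c • o`, and then `c ^ k = 1`.

Along a path of `Ω ^ k`-preserving diffeomorphisms starting at the identity, the pullback of `Ω`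
is thus `±Ω` at each point, and by continuity in time the sign remains `+`.
-/

namespace SymplecticPowers

section BlockPermutations

open Equiv

variable {ι κ : Type*}

theorem exists_apply_eq_of_fst_apply_eq [Finite ι] [Finite κ] [Nonempty κ] {σ : Perm (ι × κ)}
    (h : ∀ i j j', (σ (i, j)).1 = (σ (i, j')).1) :
    ∃ (τ : Perm ι) (ρ : ι → Perm κ), ∀ i j, σ (i, j) = (τ i, ρ i j) := by
  obtain ⟨j₀⟩ := ‹Nonempty κ›
  have hτ : Function.Surjective fun i => (σ (i, j₀)).1 := fun i' => by
    obtain ⟨⟨i, j⟩, hij⟩ := σ.surjective (i', j₀)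
    exact ⟨i, by simp only [h i j₀ j, hij]⟩
  have hρ (i : ι) : Function.Injective fun j => (σ (i, j)).2 := fun j j' hj =>
    (Prod.mk.inj (σ.injective (Prod.ext (h i j j') hj))).2
  exact ⟨.ofBijective _ hτ.bijective_of_finite, fun i => .ofBijective _ (hρ i).bijective_of_finite,
    fun i j => Prod.ext (h i j j₀) rfl⟩

theorem sign_eq_of_apply_eq [Fintype ι] [DecidableEq ι] [Fintype κ] [DecidableEq κ]
    {σ : Perm (ι × κ)} {τ : Perm ι} {ρ : ι → Perm κ} (h : ∀ i j, σ (i, j) = (τ i, ρ i j)) :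
    Perm.sign σ = Perm.sign τ ^ Fintype.card κ * ∏ i, Perm.sign (ρ i) := by
  have hσ : σ = prodCongrLeft (fun _ : κ => τ) * prodCongrRight ρ := by
    ext1 ⟨i, j⟩
    simp [h]
  rw [hσ, Perm.sign_mul, Perm.sign_prodCongrLeft, Perm.sign_prodCongrRight, Finset.prod_const,
    Finset.card_univ]

end BlockPermutations

section MultilinearAlgebra

variable {R M N ι κ : Type*} [CommRing R] [AddCommGroup M] [Module R M] [AddCommGroup N]
  [Module R N]

theorem alternatization_domDomCongr [Fintype ι] [DecidableEq ι] [Fintype κ] [DecidableEq κ]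
    (e : ι ≃ κ) (A : MultilinearMap R (fun _ : ι => M) N) :
    MultilinearMap.alternatization (A.domDomCongr e) =
      (MultilinearMap.alternatization A).domDomCongr e := by
  ext v
  simp only [AlternatingMap.domDomCongr_apply, MultilinearMap.alternatization_apply,
    MultilinearMap.domDomCongr_apply]
  exact (Fintype.sum_equiv e.permCongr _ _ fun σ => by simp).symm

theorem map_update_sum_smul [Fintype ι] [DecidableEq ι] (g : M [⋀^ι]→ₗ[R] N) (c : ι → R)
    (w : ι → M) (i : ι) : g (Function.update w i (∑ q, c q • w q)) = c i • g w := by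
  rw [g.map_update_sum, Finset.sum_eq_single i, g.map_update_smul, Function.update_eq_self]
  · intro q _ hq
    rw [g.map_update_smul, g.map_update_self w hq.symm, smul_zero]
  · simp

/-- The bilinear form `(x, y) ↦ a (x, y)` underlying a 2-form `a`. -/
def bilin (a : M [⋀^Fin 2]→ₗ[R] R) : LinearMap.BilinForm R M :=
  LinearMap.mk₂ R (fun x y => a ![x, y])
    (fun x x' y => a.map_vecCons_add ![y] x x')
    (fun c x y => a.map_vecCons_smul ![y] c x)
    (fun x y y' => (a.curryLeft x).map_vecCons_add ![] y y')
    (fun c x y => (a.curryLeft x).map_vecCons_smul ![] c y)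

theorem apply_eq_bilin (a : M [⋀^Fin 2]→ₗ[R] R) (v : Fin 2 → M) : a v = bilin a (v 0) (v 1) :=
  congrArg a (FinVec.etaExpand_eq v).symm

theorem bilin_isAlt (a : M [⋀^Fin 2]→ₗ[R] R) : (bilin a).IsAlt := fun x =>
  a.map_eq_zero_of_eq ![x, x] (i := 0) (j := 1) rfl zero_ne_one

theorem bilin_smul (c : R) (a : M [⋀^Fin 2]→ₗ[R] R) : bilin (c • a) = c • bilin a := rfl

theorem bilin_injective : Function.Injective (bilin : (M [⋀^Fin 2]→ₗ[R] R) → _) := by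
  intro a a' h
  ext v
  rw [apply_eq_bilin, apply_eq_bilin, h]

theorem apply_eq_zero_of_bilin_eq_zero (a : M [⋀^Fin 2]→ₗ[R] R) {v : Fin 2 → M} {j : Fin 2}
    (h : ∀ j' ≠ j, bilin a (v j) (v j') = 0) : a v = 0 := by
  rw [apply_eq_bilin]
  fin_cases j
  · exact h 1 (by decide)
  · exact (bilin_isAlt a).isRefl _ _ (h 0 (by decide))

end MultilinearAlgebra

section ExteriorPower

variable {V W : Type*} [AddCommGroup V] [Module ℝ V] [AddCommGroup W] [Module ℝ W]

/-- The enumeration of `Fin (2 * k)` by consecutive pairs: `(i, j) ↦ 2 * i + j`. It indexes the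
arguments of a `k`-th power by the `k` factors and the two arguments of each factor. -/
def pairEquiv (k : ℕ) : Fin k × Fin 2 ≃ Fin (2 * k) :=
  finProdFinEquiv.trans (finCongr (Nat.mul_comm k 2))

/-- The tensor product of two multilinear forms, the non-alternating counterpart of `wedge`. -/
noncomputable def tensor {p q : ℕ} (A : MultilinearMap ℝ (fun _ : Fin p => V) ℝ)
    (B : MultilinearMap ℝ (fun _ : Fin q => V) ℝ) : MultilinearMap ℝ (fun _ : Fin (p + q) => V) ℝ :=
  ((LinearMap.mul' ℝ ℝ).compMultilinearMap (A.domCoprod B)).domDomCongr finSumFinEquiv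

/-- The `k`-th tensor power of a bilinear form, the non-alternating counterpart of `wedgePow`. -/
noncomputable def tensorPow (B : MultilinearMap ℝ (fun _ : Fin 2 => V) ℝ) :
    (k : ℕ) → MultilinearMap ℝ (fun _ : Fin (2 * k) => V) ℝ
  | 0 => MultilinearMap.constOfIsEmpty ℝ (fun _ : Fin 0 => V) 1
  | k + 1 => tensor (tensorPow B k) B

theorem tensorPow_apply (B : MultilinearMap ℝ (fun _ : Fin 2 => V) ℝ) (k : ℕ)
    (v : Fin (2 * k) → V) :
    tensorPow B k v = ∏ i, B fun j => v (pairEquiv k (i, j)) := by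
  induction k with
  | zero => rfl
  | succ k ih =>
    have hlast (j : Fin 2) : finSumFinEquiv (Sum.inr j) = pairEquiv (k + 1) (Fin.last k, j) :=
      Fin.ext (add_comm _ _)
    simp only [tensorPow, tensor, MultilinearMap.domDomCongr_apply,
      LinearMap.compMultilinearMap_apply, MultilinearMap.domCoprod_apply, LinearMap.mul'_apply,
      ih, Fin.prod_univ_castSucc, hlast]
    rfl

theorem wedge_alternatization {p q : ℕ} (A : MultilinearMap ℝ (fun _ : Fin p => V) ℝ)
    (B : MultilinearMap ℝ (fun _ : Fin q => V) ℝ) :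
    wedge (MultilinearMap.alternatization A) (MultilinearMap.alternatization B) =
      MultilinearMap.alternatization (tensor A B) := by
  rw [wedge, tensor, alternatization_domDomCongr, LinearMap.compMultilinearMap_alternatization,
    MultilinearMap.domCoprod_alternization]

theorem smul_wedge_smul {p q : ℕ} (c d : ℝ) (a : V [⋀^Fin p]→ₗ[ℝ] ℝ) (b : V [⋀^Fin q]→ₗ[ℝ] ℝ) :
    wedge (c • a) (d • b) = (c * d) • wedge a b := by
  simp only [wedge, ← AlternatingMap.domCoprod'_apply, TensorProduct.smul_tmul_smul, map_smul]
  ext v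
  simp

theorem wedgePow_smul (c : ℝ) (a : V [⋀^Fin 2]→ₗ[ℝ] ℝ) (k : ℕ) :
    wedgePow (c • a) k = c ^ k • wedgePow a k := by
  induction k with
  | zero => simp [wedgePow]
  | succ k ih => rw [wedgePow, ih, smul_wedge_smul, pow_succ, wedgePow]

theorem wedgePow_alternatization (B : MultilinearMap ℝ (fun _ : Fin 2 => V) ℝ) (k : ℕ) :
    wedgePow (MultilinearMap.alternatization B) k =
      MultilinearMap.alternatization (tensorPow B k) := by
  induction k with
  | zero =>
    ext v
    have : Unique (Equiv.Perm (Fin (2 * 0))) := inferInstanceAs (Unique (Equiv.Perm (Fin 0)))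
    have hsign (σ : Equiv.Perm (Fin (2 * 0))) : Equiv.Perm.sign σ = 1 := by
      rw [Subsingleton.elim σ 1, Equiv.Perm.sign_one]
    rw [MultilinearMap.alternatization_apply, Fintype.sum_unique, hsign, one_smul]
    rfl
  | succ k ih => rw [wedgePow, tensorPow, ih, wedge_alternatization]

theorem two_pow_mul_wedgePow_apply (a : V [⋀^Fin 2]→ₗ[ℝ] ℝ) (k : ℕ) (v : Fin (2 * k) → V) :
    2 ^ k * wedgePow a k v = ∑ σ : Equiv.Perm (Fin k × Fin 2), Equiv.Perm.sign σ •
      ∏ i, a fun j => v (pairEquiv k (σ (i, j))) := by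
  have ha : (2 : ℝ) • a = MultilinearMap.alternatization (a : MultilinearMap ℝ _ ℝ) := by
    rw [AlternatingMap.coe_alternatization, Fintype.card_fin, Nat.factorial_two,
      ofNat_smul_eq_nsmul]
  rw [← smul_eq_mul, ← AlternatingMap.smul_apply, ← wedgePow_smul, ha, wedgePow_alternatization,
    MultilinearMap.alternatization_apply]
  refine (Fintype.sum_equiv (pairEquiv k).permCongr _ _ fun σ => ?_).symm
  simp [tensorPow_apply]

theorem wedgePow_compLinearMap (a : V [⋀^Fin 2]→ₗ[ℝ] ℝ) (L : W →ₗ[ℝ] V) (k : ℕ) :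
    wedgePow (a.compLinearMap L) k = (wedgePow a k).compLinearMap L := by
  ext v
  refine mul_left_cancel₀ (pow_ne_zero k (two_ne_zero' ℝ)) ?_
  simp only [AlternatingMap.compLinearMap_apply, two_pow_mul_wedgePow_apply]

theorem wedgePow_eq_zero_of_orthogonal (a : V [⋀^Fin 2]→ₗ[ℝ] ℝ) {k : ℕ} {v : Fin (2 * k) → V}
    {p : Fin (2 * k)} (h : ∀ q ≠ p, bilin a (v p) (v q) = 0) : wedgePow a k v = 0 := by
  refine (mul_eq_zero_iff_left (pow_ne_zero k (two_ne_zero' ℝ))).1 ?_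
  rw [two_pow_mul_wedgePow_apply]
  refine Finset.sum_eq_zero fun σ _ => ?_
  obtain ⟨⟨i, j⟩, rfl⟩ := (σ.trans (pairEquiv k)).surjective p
  have hi : (a fun j => v (pairEquiv k (σ (i, j)))) = 0 :=
    apply_eq_zero_of_bilin_eq_zero a (j := j) fun j' hj' => h _ (by simpa using hj')
  rw [Finset.prod_eq_zero (Finset.mem_univ i) hi, smul_zero]

end ExteriorPower

section HyperbolicFamily

variable {K V : Type*} [Field K] [AddCommGroup V] [Module K V] {b : LinearMap.BilinForm K V}

/-- A family of pairwise orthogonal hyperbolic pairs `w i 0`, `w i 1` of an alternating form `b`;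
for a symplectic form this is a partial symplectic basis. -/
structure IsHyperbolicFamily {ι : Type*} (b : LinearMap.BilinForm K V) (w : ι → Fin 2 → V) :
    Prop where
  pairing : ∀ i, b (w i 0) (w i 1) = 1
  orthogonal : ∀ {i j}, i ≠ j → ∀ s t, b (w i s) (w j t) = 0

theorem IsHyperbolicFamily.cons (hb : b.IsAlt) {k : ℕ} {w : Fin k → Fin 2 → V}
    (hw : IsHyperbolicFamily b w) {x : Fin 2 → V} (hx : b (x 0) (x 1) = 1)
    (hxw : ∀ s i t, b (x s) (w i t) = 0) :
    IsHyperbolicFamily b (Fin.cons x w : Fin (k + 1) → Fin 2 → V) where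
  pairing := Fin.cases hx hw.pairing
  orthogonal {i j} hij s t := by
    induction i using Fin.cases with
    | zero =>
      induction j using Fin.cases with
      | zero => exact absurd rfl hij
      | succ j => exact hxw s j t
    | succ i =>
      induction j using Fin.cases with
      | zero => exact hb.isRefl _ _ (hxw t i s)
      | succ j => exact hw.orthogonal (fun h => hij (congrArg Fin.succ h)) s t

theorem le_inf_orthogonalBilin_sup_span_pair (hb : b.IsAlt) {U : Submodule K V} {x y : V}
    (hx : x ∈ U) (hy : y ∈ U) (hxy : b x y = 1) :
    U ≤ U ⊓ (Submodule.span K {x, y}).orthogonalBilin b ⊔ Submodule.span K {x, y} := by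
  intro z hz
  have hyx : b y x = -1 := by rw [← hb.neg_eq, hxy]
  set z' := z + b y z • x - b x z • y with hz'
  have hz'U : z' ∈ U := U.sub_mem (U.add_mem hz (U.smul_mem _ hx)) (U.smul_mem _ hy)
  have hspan : Submodule.span K {x, y} ≤ LinearMap.ker (b.flip z') :=
    Submodule.span_le.2 (Set.pair_subset (by simp [z', hxy, hb x]) (by simp [z', hyx, hb y]))
  rw [show z = z' + (-b y z • x + b x z • y) by rw [hz']; module]
  exact Submodule.add_mem_sup ⟨hz'U, hspan⟩ (Submodule.mem_span_pair.2 ⟨_, _, rfl⟩)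

theorem finrank_le_finrank_inf_orthogonalBilin_add_two [FiniteDimensional K V] (hb : b.IsAlt)
    {U : Submodule K V} {x y : V} (hx : x ∈ U) (hy : y ∈ U) (hxy : b x y = 1) :
    Module.finrank K U ≤
      Module.finrank K ↥(U ⊓ (Submodule.span K {x, y}).orthogonalBilin b) + 2 := by
  classical
  have hspan : Module.finrank K (Submodule.span K ({x, y} : Set V)) ≤ 2 := by
    have h := finrank_span_finset_le_card (R := K) ({x, y} : Finset V)
    rw [Finset.coe_pair] at h
    exact h.trans Finset.card_le_two
  calc Module.finrank K U
      ≤ _ := Submodule.finrank_mono (le_inf_orthogonalBilin_sup_span_pair hb hx hy hxy)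
    _ ≤ _ := Submodule.finrank_add_le_finrank_add_finrank _ _
    _ ≤ _ := by gcongr

theorem inf_orthogonalBilin_le_of_le_sup (hb : b.IsRefl) {U T U' : Submodule K V} (hU' : U' ≤ U)
    (hT : U' ≤ T.orthogonalBilin b) (hU : U ≤ U' ⊔ T) :
    U' ⊓ U'.orthogonalBilin b ≤ U ⊓ U.orthogonalBilin b := by
  rintro z ⟨hzU', hz⟩
  have hker : U' ⊔ T ≤ LinearMap.ker (b z) :=
    sup_le (fun u hu => hb _ _ (hz u hu)) fun t ht => hb _ _ (hT hzU' t ht)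
  exact ⟨hU' hzU', fun u hu => hb _ _ (hker (hU hu))⟩

theorem exists_apply_eq_one_of_notMem_orthogonalBilin (hb : b.IsRefl) {U : Submodule K V} {x : V}
    (hx : x ∉ U.orthogonalBilin b) : ∃ y ∈ U, b x y = 1 := by
  obtain ⟨y, hyU, hyx⟩ : ∃ y ∈ U, b y x ≠ 0 := by
    by_contra! h
    exact hx h
  have hxy : b x y ≠ 0 := fun h => hyx (hb _ _ h)
  exact ⟨(b x y)⁻¹ • y, U.smul_mem _ hyU, by rw [map_smul, smul_eq_mul, inv_mul_cancel₀ hxy]⟩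

theorem exists_isHyperbolicFamily [FiniteDimensional K V] (hb : b.IsAlt) {k : ℕ}
    {S U : Submodule K V} (hS : U ⊓ U.orthogonalBilin b ≤ S)
    (hdim : Module.finrank K S + 2 * k < Module.finrank K U) {x : V} (hxU : x ∈ U) (hxS : x ∉ S) :
    ∃ w : Fin (k + 1) → Fin 2 → V, IsHyperbolicFamily b w ∧ (∀ i s, w i s ∈ U) ∧ w 0 0 = x := by
  induction k generalizing U x with
  | zero =>
    obtain ⟨y, hyU, hxy⟩ :=
      exists_apply_eq_one_of_notMem_orthogonalBilin hb.isRefl fun h => hxS (hS ⟨hxU, h⟩)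
    refine ⟨fun _ => ![x, y], ⟨fun _ => hxy, fun h => ?_⟩, ?_, rfl⟩
    · exact absurd (Subsingleton.elim (α := Fin 1) _ _) h
    · exact fun _ => Fin.forall_fin_two.2 ⟨hxU, hyU⟩
  | succ k ih =>
    obtain ⟨y, hyU, hxy⟩ :=
      exists_apply_eq_one_of_notMem_orthogonalBilin hb.isRefl fun h => hxS (hS ⟨hxU, h⟩)
    have hrad := inf_orthogonalBilin_le_of_le_sup hb.isRefl inf_le_left inf_le_right
      (le_inf_orthogonalBilin_sup_span_pair hb hxU hyU hxy)
    have hfin := finrank_le_finrank_inf_orthogonalBilin_add_two hb hxU hyU hxy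
    obtain ⟨x', hx', hx'S⟩ := Set.not_subset.1 fun h => absurd (Submodule.finrank_mono h)
      (show ¬ Module.finrank K ↥(U ⊓ (Submodule.span K {x, y}).orthogonalBilin b) ≤
        Module.finrank K S by lia)
    obtain ⟨w, hw, hwU, -⟩ := ih (hrad.trans hS) (by lia) hx' hx'S
    refine ⟨Fin.cons ![x, y] w, hw.cons hb hxy ?_, ?_, rfl⟩
    · exact Fin.forall_fin_two.2
        ⟨fun i t => (hwU i t).2 x (Submodule.subset_span (by simp)),
          fun i t => (hwU i t).2 y (Submodule.subset_span (by simp))⟩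
    · exact Fin.cases (Fin.forall_fin_two.2 ⟨hxU, hyU⟩) fun i s => (hwU i s).1

theorem IsHyperbolicFamily.wedgePow_pos {V : Type*} [AddCommGroup V] [Module ℝ V]
    {a : V [⋀^Fin 2]→ₗ[ℝ] ℝ} {k : ℕ} {w : Fin k → Fin 2 → V}
    (hw : IsHyperbolicFamily (bilin a) w) :
    0 < wedgePow a k fun p => Function.uncurry w ((pairEquiv k).symm p) := by
  have hone (i : Fin k) : a (w i) = 1 := (apply_eq_bilin a _).trans (hw.pairing i)
  refine (mul_pos_iff_of_pos_left (pow_pos (two_pos (α := ℝ)) k)).1 ?_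
  simp only [two_pow_mul_wedgePow_apply, Equiv.symm_apply_apply]
  refine Finset.sum_pos' (fun σ _ => ?_) ⟨1, Finset.mem_univ _, by simp [Function.uncurry, hone]⟩
  -- A term is `1` if `σ` maps pairs to pairs; otherwise two orthogonal vectors share a factor `a`.
  by_cases hσ : ∀ i j j', (σ (i, j)).1 = (σ (i, j')).1
  · obtain ⟨τ, ρ, hτρ⟩ := exists_apply_eq_of_fst_apply_eq hσ
    have hblock (i : Fin k) :
        (a fun j => Function.uncurry w (σ (i, j))) = Equiv.Perm.sign (ρ i) • (1 : ℝ) := by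
      simp only [hτρ, Function.uncurry_apply_pair, ← hone (τ i)]
      exact a.map_perm (w (τ i)) (ρ i)
    have hsign : Equiv.Perm.sign σ = ∏ i, Equiv.Perm.sign (ρ i) := by
      rw [sign_eq_of_apply_eq hτρ, Fintype.card_fin, Int.units_sq, one_mul]
    simp only [hblock, Finset.prod_smul, hsign]
    rw [smul_smul, Int.units_mul_self, one_smul]
    simp
  · push Not at hσ
    obtain ⟨i, j, j', hjj'⟩ := hσ
    have hblock : (a fun j => Function.uncurry w (σ (i, j))) = 0 :=
      apply_eq_zero_of_bilin_eq_zero a (j := j) fun j'' hj'' => by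
        have : j'' = j' := by grind
        exact hw.orthogonal (this ▸ hjj') _ _
    rw [Finset.prod_eq_zero (Finset.mem_univ i) hblock, smul_zero]

end HyperbolicFamily

section Rigidity

section Field

variable {K V ι : Type*} [Field K] [AddCommGroup V] [Module K V]

theorem exists_ne_zero_forall_apply_sum_eq_zero [NeZero (2 : K)] [Fintype ι]
    (hι : Odd (Fintype.card ι)) {b : LinearMap.BilinForm K V} (hb : b.IsAlt) (z : ι → V) :
    ∃ c : ι → K, c ≠ 0 ∧ ∀ p, b (z p) (∑ q, c q • z q) = 0 := by
  classical
  let A : Matrix ι ι K := Matrix.of fun p q => b (z p) (z q)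
  have hA : A.transpose = -A := by
    ext p q
    exact (hb.neg_eq _ _).symm
  have hdet : A.det = 0 := by
    have h : A.det = -A.det := by
      rw [← neg_one_mul, ← hι.neg_one_pow, ← Matrix.det_neg, ← hA, Matrix.det_transpose]
    exact (mul_eq_zero_iff_left two_ne_zero).1 (by linear_combination h)
  obtain ⟨c, hc, hAc⟩ := Matrix.exists_mulVec_eq_zero_iff.2 hdet
  refine ⟨c, hc, fun p => ?_⟩
  simpa [A, Matrix.mulVec, dotProduct, mul_comm] using congrFun hAc p

theorem exists_eq_smul_of_forall_apply_eq_zero {a o : LinearMap.BilinForm K V}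
    (h : ∀ x y, o x y = 0 → a x y = 0) : ∃ c : K, a = c • o := by
  by_cases ho : o = 0
  · exact ⟨0, by ext x y; simp [h x y, ho]⟩
  obtain ⟨x₀, y₀, h₀⟩ : ∃ x₀ y₀, o x₀ y₀ ≠ 0 := by
    by_contra! h0
    exact ho (LinearMap.ext₂ h0)
  have hright (x y z : V) : a x y * o x z = a x z * o x y := by
    have := h x (o x z • y - o x y • z) (by simp [mul_comm])
    simp only [map_sub, map_smul, smul_eq_mul] at this
    linear_combination this
  have hleft (x y z : V) : a x z * o y z = a y z * o x z := by
    have := h (o y z • x - o x z • y) z (by simp [mul_comm])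
    simp only [map_sub, map_smul, LinearMap.sub_apply, LinearMap.smul_apply, smul_eq_mul] at this
    linear_combination this
  have hgen (x y : V) (hx : o x y₀ ≠ 0) : a x y * o x₀ y₀ = a x₀ y₀ * o x y := by
    refine mul_right_cancel₀ hx ?_
    linear_combination o x₀ y₀ * hright x y y₀ + o x y * hleft x x₀ y₀
  refine ⟨a x₀ y₀ / o x₀ y₀, LinearMap.ext₂ fun x y => ?_⟩
  rw [LinearMap.smul_apply, LinearMap.smul_apply, smul_eq_mul, div_mul_eq_mul_div,
    eq_div_iff h₀]
  by_cases hx : o x y₀ = 0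
  · have hsum := hgen (x + x₀) y (by simpa [hx] using h₀)
    simp only [map_add, LinearMap.add_apply] at hsum
    linear_combination hsum - hgen x₀ y h₀
  · exact hgen x y hx

theorem ker_inf_orthogonalBilin_le {o : LinearMap.BilinForm K V} (ho : o.IsRefl) (v : V) :
    LinearMap.ker (o v) ⊓ (LinearMap.ker (o v)).orthogonalBilin o ≤
      Submodule.span K {v} ⊔ LinearMap.ker o := by
  rintro x ⟨-, hx⟩
  have hmem : o x ∈ Submodule.span K (Set.range fun _ : Unit => o v) :=
    mem_span_of_iInf_ker_le_ker fun y hy => ho _ _ (hx y ((Submodule.mem_iInf _).1 hy ()))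
  rw [Set.range_const] at hmem
  obtain ⟨c, hc⟩ := Submodule.mem_span_singleton.1 hmem
  rw [← add_sub_cancel (c • v) x]
  refine Submodule.add_mem_sup (Submodule.mem_span_singleton.2 ⟨c, rfl⟩) ?_
  rw [LinearMap.mem_ker, map_sub, map_smul, hc, sub_self]

theorem finrank_range_add_finrank_le_finrank_ker_add_two [FiniteDimensional K V]
    (o : LinearMap.BilinForm K V) (v : V) :
    Module.finrank K (LinearMap.range o) +
        Module.finrank K ↥(Submodule.span K {v} ⊔ LinearMap.ker o) ≤
      Module.finrank K (LinearMap.ker (o v)) + 2 := by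
  have hspan := Submodule.finrank_add_le_finrank_add_finrank (Submodule.span K {v})
    (LinearMap.ker o)
  have hv := finrank_span_le_card (R := K) ({v} : Set V)
  rw [Set.toFinset_singleton, Finset.card_singleton] at hv
  have ho := LinearMap.finrank_range_add_finrank_ker o
  have hov := LinearMap.finrank_range_add_finrank_ker (o v)
  have hline := Submodule.finrank_le (LinearMap.range (o v))
  rw [Module.finrank_self] at hline
  lia

end Field

variable {V : Type*} [AddCommGroup V] [Module ℝ V] {a o : V [⋀^Fin 2]→ₗ[ℝ] ℝ} {k : ℕ}

theorem bilin_eq_zero_of_wedgePow_eq (h : wedgePow a k = wedgePow o k) {v : V}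
    {w : Fin (2 * k) → V} (hvw : ∀ i, bilin o v (w i) = 0) (hw : wedgePow o k w ≠ 0)
    (i : Fin (2 * k)) : bilin a v (w i) = 0 := by
  obtain ⟨c, hc, hker⟩ := exists_ne_zero_forall_apply_sum_eq_zero
    (by rw [Fintype.card_fin]; exact odd_two_mul_add_one k) (bilin_isAlt a)
    (Fin.cons v w : Fin (2 * k + 1) → V)
  simp only [Fin.sum_univ_succ, Fin.cons_zero, Fin.cons_succ] at hker
  set x := c 0 • v + ∑ q, c q.succ • w q with hx
  have hxw (q : Fin (2 * k)) : bilin a x (w q) = 0 := (bilin_isAlt a).isRefl _ _ (hker q.succ)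
  have hcw (q : Fin (2 * k)) : c q.succ = 0 := by
    have hax : wedgePow a k (Function.update w q x) = 0 :=
      wedgePow_eq_zero_of_orthogonal a (p := q) fun r hr => by
        rw [Function.update_self, Function.update_of_ne hr, hxw]
    have hov : wedgePow o k (Function.update w q v) = 0 :=
      wedgePow_eq_zero_of_orthogonal o (p := q) fun r hr => by
        rw [Function.update_self, Function.update_of_ne hr, hvw]
    rw [h, hx, AlternatingMap.map_update_add, AlternatingMap.map_update_smul, hov, smul_zero,
      zero_add, map_update_sum_smul, smul_eq_mul] at hax
    exact (mul_eq_zero.1 hax).resolve_right hw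
  have hxv : x = c 0 • v := by simp [hx, hcw]
  have hc0 : c 0 ≠ 0 := fun h0 => hc (funext (Fin.cases h0 hcw))
  have hi := hxw i
  rw [hxv, map_smul, LinearMap.smul_apply, smul_eq_mul] at hi
  exact (mul_eq_zero.1 hi).resolve_left hc0

variable [FiniteDimensional ℝ V]

theorem ker_bilin_le_ker_bilin (hk : 0 < k)
    (ho : 2 * k < Module.finrank ℝ (LinearMap.range (bilin o)))
    (h : wedgePow a k = wedgePow o k) (v : V) :
    LinearMap.ker (bilin o v) ≤ LinearMap.ker (bilin a v) := by
  obtain ⟨k, rfl⟩ := Nat.exists_eq_succ_of_ne_zero hk.ne'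
  have hrank := finrank_range_add_finrank_le_finrank_ker_add_two (bilin o) v
  have hcover : (LinearMap.ker (bilin o v) : Set V) ⊆
      ↑(Submodule.span ℝ {v} ⊔ LinearMap.ker (bilin o)) ∪ ↑(LinearMap.ker (bilin a v)) := by
    refine fun u hu => or_iff_not_imp_left.2 fun huS => ?_
    obtain ⟨w, hw, hwU, rfl⟩ := exists_isHyperbolicFamily (bilin_isAlt o) (k := k)
      (ker_inf_orthogonalBilin_le (bilin_isAlt o).isRefl v) (by omega) hu huS
    have := bilin_eq_zero_of_wedgePow_eq h (fun p => hwU _ _) hw.wedgePow_pos.ne'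
      (pairEquiv (k + 1) (0, 0))
    simpa using this
  refine (AddSubgroupClass.subset_union.1 hcover).resolve_left fun hS => ?_
  have := Submodule.finrank_mono hS
  omega

theorem wedgePow_ne_zero (ho : 2 * k ≤ Module.finrank ℝ (LinearMap.range (bilin o))) :
    wedgePow o k ≠ 0 := by
  obtain ⟨w, hw⟩ : ∃ w : Fin k → Fin 2 → V, IsHyperbolicFamily (bilin o) w := by
    cases k with
    | zero => exact ⟨nofun, nofun, fun {i} => i.elim0⟩
    | succ k =>
      have hker := LinearMap.finrank_range_add_finrank_ker (bilin o)
      obtain ⟨x, hx⟩ : ∃ x, x ∉ LinearMap.ker (bilin o) := by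
        by_contra! hx
        rw [(Submodule.eq_top_iff').2 hx, finrank_top] at hker
        omega
      obtain ⟨w, hw, -⟩ := exists_isHyperbolicFamily (bilin_isAlt o) (k := k) (U := ⊤)
        (fun z hz => LinearMap.ext fun y => (bilin_isAlt o).isRefl _ _ (hz.2 y trivial))
        (by rw [finrank_top]; omega) trivial hx
      exact ⟨w, hw⟩
  exact fun h => hw.wedgePow_pos.ne' (DFunLike.congr_fun h _)

theorem eq_or_eq_neg_of_wedgePow_eq (hk : 0 < k)
    (ho : 2 * k < Module.finrank ℝ (LinearMap.range (bilin o)))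
    (h : wedgePow a k = wedgePow o k) : a = o ∨ a = -o := by
  obtain ⟨c, hc⟩ := exists_eq_smul_of_forall_apply_eq_zero fun v _ hu =>
    ker_bilin_le_ker_bilin hk ho h v hu
  obtain rfl : a = c • o := bilin_injective (hc.trans (bilin_smul c o).symm)
  have hck : c ^ k = 1 := by
    refine smul_left_injective ℝ (wedgePow_ne_zero ho.le) ?_
    simpa only [one_smul, ← wedgePow_smul] using h
  rcases pow_eq_one_iff_cases.1 hck with rfl | rfl | ⟨rfl, -⟩
  · exact absurd hk (lt_irrefl 0)
  · exact .inl (one_smul ℝ o)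
  · exact .inr (neg_one_smul ℝ o)

end Rigidity

section Continuity

section MFDeriv

variable {𝕜 : Type*} [NontriviallyNormedField 𝕜]
  {E : Type*} [NormedAddCommGroup E] [NormedSpace 𝕜 E] {H : Type*} [TopologicalSpace H]
  {I : ModelWithCorners 𝕜 E H} {M : Type*} [TopologicalSpace M] [ChartedSpace H M]
  {E' : Type*} [NormedAddCommGroup E'] [NormedSpace 𝕜 E'] {H' : Type*} [TopologicalSpace H']
  {I' : ModelWithCorners 𝕜 E' H'} {M' : Type*} [TopologicalSpace M'] [ChartedSpace H' M']
  [IsManifold I 1 M] [IsManifold I' 1 M']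

theorem inTangentCoordinates_apply_mfderiv_extChartAt {N : Type*} {f : N → M'} {x : M}
    (φ : ∀ t, TangentSpace I x →L[𝕜] TangentSpace I' (f t)) {t₀ t : N}
    (ht : f t ∈ (extChartAt I' (f t₀)).source) (v : TangentSpace I x) :
    inTangentCoordinates I I' (fun _ => x) f φ t₀ t (mfderiv I 𝓘(𝕜, E) (extChartAt I x) x v) =
      mfderiv I' 𝓘(𝕜, E') (extChartAt I' (f t₀)) (f t) (φ t v) := by
  rw [extChartAt_source] at ht
  rw [inTangentCoordinates_eq_mfderiv_comp (mem_chart_source H x) ht]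
  have hinv := DFunLike.congr_fun (mfderivWithin_extChartAt_symm_comp_mfderiv_extChartAt'
    (I := I) (mem_extChartAt_source (I := I) x)) v
  exact congrArg (fun u : TangentSpace I x =>
    mfderiv I' 𝓘(𝕜, E') (extChartAt I' (f t₀)) (f t) (φ t u)) hinv

theorem continuousWithinAt_mfderiv_extChartAt_mfderiv
    {F : Type*} [NormedAddCommGroup F] [NormedSpace 𝕜 F] {G : Type*} [TopologicalSpace G]
    {J : ModelWithCorners 𝕜 F G} {N : Type*} [TopologicalSpace N] [ChartedSpace G N]
    [IsManifold J 1 N] {n : WithTop ℕ∞} (hn : 1 ≤ n) {f : N → M → M'} {s : Set N} {t₀ : N}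
    (ht₀ : t₀ ∈ s) {x : M}
    (hf : ContMDiffWithinAt (I.prod J) I' n (fun q : M × N => f q.2 q.1) (Set.univ ×ˢ s) (x, t₀))
    (v : TangentSpace I x) :
    ContinuousWithinAt (fun t => mfderiv I' 𝓘(𝕜, E') (extChartAt I' (f t₀ x)) (f t x)
      (mfderiv I I' (f t) x v)) s t₀ := by
  have hswap : ContMDiffWithinAt (J.prod I) I' n (Function.uncurry f) (s ×ˢ Set.univ) (t₀, x) :=
    hf.comp (t := Set.univ ×ˢ s) (t₀, x)
      (contMDiff_snd.prodMk contMDiff_fst).contMDiffAt.contMDiffWithinAt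
      fun q hq => ⟨trivial, hq.1⟩
  have hfx : ContinuousWithinAt (fun t => f t x) s t₀ :=
    ContinuousWithinAt.comp (f := fun t => (x, t)) (t := Set.univ ×ˢ s) hf.continuousWithinAt
      (by fun_prop) fun t ht => ⟨trivial, ht⟩
  have hD := (hswap.mfderivWithin (m := 0) contMDiffWithinAt_const ht₀ (Set.mapsTo_univ _ _)
    (by simpa using hn) uniqueMDiffOn_univ).continuousWithinAt
  simp only [mfderivWithin_univ] at hD
  refine (hD.clm_apply (continuousWithinAt_const
    (b := mfderiv I 𝓘(𝕜, E) (extChartAt I x) x v))).congr_of_eventuallyEq_of_mem ?_ ht₀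
  filter_upwards [hfx (extChartAt_source_mem_nhds (I := I') (f t₀ x))] with t ht
  exact (inTangentCoordinates_apply_mfderiv_extChartAt (fun t => mfderiv I I' (f t) x) ht v).symm

end MFDeriv

variable {m : ℕ} {M : Type*} [TopologicalSpace M] [ChartedSpace (EuclideanSpace ℝ (Fin m)) M]
  [IsManifold (𝓡 m) 1 M] {Ω : ∀ x : M, TangentSpace (𝓡 m) x [⋀^Fin 2]→L[ℝ] ℝ}

theorem apply_eq_chartForm (Ω : ∀ x : M, TangentSpace (𝓡 m) x [⋀^Fin 2]→L[ℝ] ℝ) {x₀ y : M}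
    (hy : y ∈ (extChartAt (𝓡 m) x₀).source) (v : Fin 2 → TangentSpace (𝓡 m) y) :
    Ω y v = chartForm Ω x₀ (extChartAt (𝓡 m) x₀ y)
      fun j => mfderiv (𝓡 m) 𝓘(ℝ, EuclideanSpace ℝ (Fin m)) (extChartAt (𝓡 m) x₀) y (v j) := by
  have hinv := mfderivWithin_extChartAt_symm_comp_mfderiv_extChartAt' (I := 𝓡 m) hy
  rw [ModelWithCorners.range_eq_univ, mfderivWithin_univ] at hinv
  have hΩ (z : M) (hz : z = y) (u : Fin 2 → EuclideanSpace ℝ (Fin m)) :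
      (Ω z : EuclideanSpace ℝ (Fin m) [⋀^Fin 2]→L[ℝ] ℝ) u = Ω y u := by
    subst hz
    rfl
  refine Eq.trans ?_ (hΩ _ ((extChartAt (𝓡 m) x₀).left_inv hy) _).symm
  exact congrArg (Ω y) (funext fun j => (DFunLike.congr_fun hinv (v j)).symm)

theorem continuousWithinAt_apply_of_chartForm
    (hΩ : ∀ x₀, ContinuousOn (chartForm Ω x₀) (extChartAt (𝓡 m) x₀).target)
    {N : Type*} [TopologicalSpace N] {γ : N → M} {s : Set N} {t₀ : N} (ht₀ : t₀ ∈ s)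
    (hγ : ContinuousWithinAt γ s t₀) {u : ∀ t, Fin 2 → TangentSpace (𝓡 m) (γ t)}
    (hu : ∀ j, ContinuousWithinAt (fun t => mfderiv (𝓡 m) 𝓘(ℝ, EuclideanSpace ℝ (Fin m))
      (extChartAt (𝓡 m) (γ t₀)) (γ t) (u t j)) s t₀) :
    ContinuousWithinAt (fun t => Ω (γ t) (u t)) s t₀ := by
  have hform : ContinuousAt (chartForm Ω (γ t₀)) (extChartAt (𝓡 m) (γ t₀) (γ t₀)) :=
    (hΩ (γ t₀)).continuousAt (extChartAt_target_mem_nhds (I := 𝓡 m) (γ t₀))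
  have hformγ := (hform.comp (continuousAt_extChartAt (I := 𝓡 m) (γ t₀))).comp_continuousWithinAt hγ
  have heval : Continuous fun q : (EuclideanSpace ℝ (Fin m) [⋀^Fin 2]→L[ℝ] ℝ) ×
      (Fin 2 → EuclideanSpace ℝ (Fin m)) => q.1 q.2 := by
    fun_prop
  refine (heval.continuousAt.comp_continuousWithinAt
    (hformγ.prodMk (continuousWithinAt_pi.2 hu))).congr_of_eventuallyEq_of_mem ?_ ht₀
  filter_upwards [hγ (extChartAt_source_mem_nhds (I := 𝓡 m) (γ t₀))] with t ht
  exact apply_eq_chartForm Ω ht (u t)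

theorem continuousOn_pullback_apply
    (hΩ : ∀ x₀, ContinuousOn (chartForm Ω x₀) (extChartAt (𝓡 m) x₀).target)
    {F : Type*} [NormedAddCommGroup F] [NormedSpace ℝ F] {G : Type*} [TopologicalSpace G]
    {J : ModelWithCorners ℝ F G} {N : Type*} [TopologicalSpace N] [ChartedSpace G N]
    [IsManifold J 1 N] {n : WithTop ℕ∞} (hn : 1 ≤ n) {f : N → M → M} {s : Set N}
    (hf : ContMDiffOn ((𝓡 m).prod J) (𝓡 m) n (fun q : M × N => f q.2 q.1) (Set.univ ×ˢ s))
    (x : M) (v : Fin 2 → TangentSpace (𝓡 m) x) :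
    ContinuousOn (fun t => pullback (f t) (toForm Ω) x v) s := by
  have hfx : ContinuousOn (fun t => f t x) s :=
    hf.continuousOn.comp (f := fun t => (x, t)) (by fun_prop) fun t ht => ⟨trivial, ht⟩
  exact fun t₀ ht₀ => continuousWithinAt_apply_of_chartForm hΩ ht₀ (hfx t₀ ht₀) fun j =>
    continuousWithinAt_mfderiv_extChartAt_mfderiv hn ht₀ (hf (x, t₀) ⟨trivial, ht₀⟩) (v j)

end Continuity

section Diffeomorphisms

variable {m : ℕ} {M : Type*} [TopologicalSpace M] [ChartedSpace (EuclideanSpace ℝ (Fin m)) M]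
  {Ω : ∀ x : M, TangentSpace (𝓡 m) x [⋀^Fin 2]→L[ℝ] ℝ} {k : ℕ}

theorem pullback_id {p : ℕ} (η : ∀ x : M, TangentSpace (𝓡 m) x [⋀^Fin p]→ₗ[ℝ] ℝ) :
    pullback id η = η := by
  funext x
  simp only [pullback, mfderiv_id]
  rfl

theorem pullback_formPow (φ : M → M) (Ω : ∀ x : M, TangentSpace (𝓡 m) x [⋀^Fin 2]→L[ℝ] ℝ)
    (k : ℕ) (x : M) :
    pullback φ (formPow Ω k) x = wedgePow (pullback φ (toForm Ω) x) k :=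
  (wedgePow_compLinearMap _ _ _).symm

theorem symp_subset_diffPreserving_formPow (Ω : ∀ x : M, TangentSpace (𝓡 m) x [⋀^Fin 2]→L[ℝ] ℝ)
    (k : ℕ) : Symp Ω ⊆ DiffPreserving (formPow Ω k) := by
  intro φ hφ
  funext x
  rw [pullback_formPow, show pullback φ (toForm Ω) = toForm Ω from hφ]
  rfl

theorem symp₀_subset_diffPow₀ (Ω : ∀ x : M, TangentSpace (𝓡 m) x [⋀^Fin 2]→L[ℝ] ℝ) (k : ℕ) :
    Symp₀ Ω ⊆ DiffPow₀ Ω k := fun _ ⟨f, hf, hpres, h0, h1⟩ =>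
  ⟨f, hf, fun t ht => symp_subset_diffPreserving_formPow Ω k (hpres t ht), h0, h1⟩

theorem pullback_eq_or_eq_neg (hk : 0 < k) {φ : M → M}
    (hφ : pullback φ (formPow Ω k) = formPow Ω k) {x : M}
    (hx : 2 * k < Module.finrank ℝ (LinearMap.range (bilin (toForm Ω x)))) :
    pullback φ (toForm Ω) x = toForm Ω x ∨ pullback φ (toForm Ω) x = -toForm Ω x := by
  have : FiniteDimensional ℝ (TangentSpace (𝓡 m) x) :=
    inferInstanceAs (FiniteDimensional ℝ (EuclideanSpace ℝ (Fin m)))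
  refine eq_or_eq_neg_of_wedgePow_eq hk hx ?_
  rw [← pullback_formPow, hφ]
  rfl

theorem pullback_eq_of_path {η : ∀ x : M, TangentSpace (𝓡 m) x [⋀^Fin 2]→ₗ[ℝ] ℝ} {f : ℝ → M → M}
    {x : M} (hcont : ∀ v, ContinuousOn (fun t => pullback (f t) η x v) (Set.Icc 0 1))
    (hsign : ∀ t ∈ Set.Icc (0 : ℝ) 1, pullback (f t) η x = η x ∨ pullback (f t) η x = -η x)
    (h0 : f 0 = id) {t : ℝ} (ht : t ∈ Set.Icc (0 : ℝ) 1) : pullback (f t) η x = η x := by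
  have hid : pullback (f 0) η x = η x := by rw [h0, pullback_id]
  ext v
  by_cases hv : η x v = 0
  · rcases hsign t ht with h | h <;> simp [h, hv]
  · refine isPreconnected_Icc.eq_of_sq_eq (g := fun _ => η x v) (hcont v) continuousOn_const
      (fun s hs => ?_) (fun _ => hv) (Set.left_mem_Icc.2 zero_le_one)
      (DFunLike.congr_fun hid v) ht
    rcases hsign s hs with h | h <;> simp [h]

theorem diffPow₀_subset_symp₀ [IsManifold (𝓡 m) 1 M]
    (hΩ : ∀ x₀, ContinuousOn (chartForm Ω x₀) (extChartAt (𝓡 m) x₀).target) (hk : 0 < k)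
    (hrank : ∀ x, 2 * k < Module.finrank ℝ (LinearMap.range (bilin (toForm Ω x)))) :
    DiffPow₀ Ω k ⊆ Symp₀ Ω := by
  rintro φ ⟨f, hf, hpres, h0, h1⟩
  refine ⟨f, hf, fun t ht => funext fun x => ?_, h0, h1⟩
  exact pullback_eq_of_path (f := fun t => f t)
    (continuousOn_pullback_apply hΩ (by simp) hf x)
    (fun s hs => pullback_eq_or_eq_neg hk (hpres s hs) (hrank x)) (by rw [h0]; rfl) ht

theorem symp₀_subset_symp (Ω : ∀ x : M, TangentSpace (𝓡 m) x [⋀^Fin 2]→L[ℝ] ℝ) :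
    Symp₀ Ω ⊆ Symp Ω := fun _ ⟨_, _, hpres, _, h1⟩ =>
  h1 ▸ hpres 1 (Set.right_mem_Icc.2 zero_le_one)

theorem IsSymplecticForm.finrank_range_bilin (hΩ : IsSymplecticForm Ω) (x : M) :
    Module.finrank ℝ (LinearMap.range (bilin (toForm Ω x))) = m := by
  have hinj : Function.Injective (bilin (toForm Ω x)) :=
    (injective_iff_map_eq_zero _).2 fun v hv =>
      hΩ.nondegenerate x v fun w => DFunLike.congr_fun hv w
  exact (LinearMap.finrank_range_of_inj hinj).trans finrank_euclideanSpace_fin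

end Diffeomorphisms

end SymplecticPowers

open SymplecticPowers in
theorem theorem1_general {m k : ℕ} (hk : 0 < k) {M : Type*} [TopologicalSpace M]
    [ChartedSpace (EuclideanSpace ℝ (Fin m)) M] [IsManifold (𝓡 m) 1 M]
    {Ω : ∀ x : M, TangentSpace (𝓡 m) x [⋀^Fin 2]→L[ℝ] ℝ}
    (hΩ : ∀ x₀, ContinuousOn (chartForm Ω x₀) (extChartAt (𝓡 m) x₀).target)
    (hrank : ∀ x, 2 * k < Module.finrank ℝ (LinearMap.range (bilin (toForm Ω x)))) :
    DiffPow₀ Ω k ⊆ Symp Ω ∧ DiffPow₀ Ω k = Symp₀ Ω :=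
  have hsubset := diffPow₀_subset_symp₀ hΩ hk hrank
  ⟨hsubset.trans (symp₀_subset_symp Ω), hsubset.antisymm (symp₀_subset_diffPow₀ Ω k)⟩

open scoped Manifold ContDiff in
theorem theorem1 (n k : ℕ) (hn : 2 < n) (hk : 0 < k) (hkn : k < n)
    (M : Type*) [TopologicalSpace M] [ChartedSpace (EuclideanSpace ℝ (Fin (2 * n))) M]
    [IsManifold (𝓡 (2 * n)) ∞ M]
    (Ω : ∀ x : M, TangentSpace (𝓡 (2 * n)) x [⋀^Fin 2]→L[ℝ] ℝ)
    (hΩ : SymplecticPowers.IsSymplecticForm Ω) :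
    SymplecticPowers.DiffPow₀ Ω k ⊆ SymplecticPowers.Symp Ω ∧
      SymplecticPowers.DiffPow₀ Ω k = SymplecticPowers.Symp₀ Ω :=
  theorem1_general hk (fun x₀ => (hΩ.smooth x₀).continuousOn) fun x => by
    rw [hΩ.finrank_range_bilin]
    lia
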